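/- Fix a countably infinite set of values; each value is also a constant denoting itself, so distinct constants denote distinct values. A schema $\mathbf S=\mathbf S_h\cup\mathbf S_v$ is a finite set of relation names with arities $\ge 0$, partitioned into hidden relations $\mathbf S_h$ and visible relations $\mathbf S_v$. An instance maps each relation to a set of tuples of values of its arity; it is finite if it contains finitely many tuples in total. $\mathsf{Visible}(\mathcal F)$ denotes the restriction of an $\mathbf S$-instance $\mathcal F$ to $\mathbf S_v$. A Boolean UCQ is a finite nonempty disjunction of existentially closed, finite nonempty conjunctions of relational atoms. A disjunctive linear TGD is a sentence $\forall\bar x\,\big(\phi(\bar x)\rightarrow\exists\bar y\,\bigvee_i\rho_i(\bar x,\bar y)\big)$, where $\phi$ is a single relational atom containing all the variables $\bar x$, the disjunction is finite and nonempty, and each $\rho_i$ is a finite nonempty conjunction of relational atoms. Atoms may contain variables and constants. For a Boolean UCQ $Q$ over $\mathbf S$ and a finite set $\mathcal C$ of disjunctive linear TGDs over $\mathbf S$, let $\exists\mathsf{PQI}(Q,\mathcal C,\mathbf S)=\mathsf{true}$ if there is a finite $\mathbf S_v$-instance $\mathcal V$ such that (i) $\mathcal V=\mathsf{Visible}(\mathcal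 F)$ for some finite $\mathbf S$-instance $\mathcal F$ satisfying $\mathcal C$, and (ii) every finite $\mathbf S$-instance $\mathcal F$ that satisfies $\mathcal C$ and has $\mathsf{Visible}(\mathcal F)=\mathcal V$ satisfies $Q$. Theorem 3.10. The problem of deciding, given $\mathbf S$, a Boolean UCQ $Q$ over $\mathbf S$ and a finite set $\mathcal C$ of disjunctive linear TGDs over $\mathbf S$, whether $\exists\mathsf{PQI}(Q,\mathcal C,\mathbf S)=\mathsf{true}$ is undecidable. The same is true of the unrestricted version of the problem, in which the instances $\mathcal V$ and $\mathcal F$ may be finite or infinite. Both problems remain undecidable when the inputs are restricted to those in which no constants occur in $Q$ or $\mathcal C$. -/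

import Mathlib

namespace HiddenQI

/-! ### Syntax

All syntactic objects are built from natural numbers by pairs, sums and lists, so that they
are inputs of algorithms in the sense of Mathlib's `Primcodable` / `Computable`.
The values (= constants, under the unique name assumption) are the natural numbers. -/

/-- A relation of a schema: its visibility flag (`true` for visible, `false` for hidden) and
its arity. -/
abbrev RelDecl := Bool × ℕ

/-- A schema: a finite list of relations. The name of a relation is its position in the list. -/
abbrev Schema := List RelDecl

/-- A term: `Sum.inl x` is the variable number `x`, `Sum.inr c` is the constant `c`. -/
abbrev Trm := ℕ ⊕ ℕ

/-- A relational atom: a relation name and its list of arguments. -/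
abbrev Atom := ℕ × List Trm

/-- A Boolean conjunctive query: a conjunction of atoms, all variables being existentially
quantified. -/
abbrev BCQ := List Atom

/-- A Boolean union of conjunctive queries: a disjunction of Boolean conjunctive queries. -/
abbrev BUCQ := List BCQ

/-- A disjunctive linear TGD `∀ x, φ(x) → ∃ y, ⋁ i, ρ i (x, y)`: the single atom `φ`, and the
list of the conjunctions of atoms `ρ i`. The variables of `φ` are the universally quantified
ones; all other variables are existentially quantified. -/
abbrev DLTGD := Atom × List (List Atom)

/-- An input of the schema-level problem: a Boolean UCQ `Q`, a finite set `C` of disjunctive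
linear TGDs, and a schema `S`. -/
abbrev Input := BUCQ × List DLTGD × Schema

/-- The atom uses a relation of the schema, with the right number of arguments. -/
def Atom.Over (S : Schema) (A : Atom) : Prop :=
  ∃ r : RelDecl, S[A.1]? = some r ∧ A.2.length = r.2

/-- `Q` is a Boolean UCQ over `S`: a nonempty disjunction of nonempty conjunctions of atoms
over `S`. -/
def BUCQ.Over (S : Schema) (Q : BUCQ) : Prop :=
  Q ≠ [] ∧ ∀ q ∈ Q, q ≠ [] ∧ ∀ A ∈ q, Atom.Over S A

/-- `τ` is a disjunctive linear TGD over `S`: its head is a nonempty disjunction of nonempty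
conjunctions of atoms, and all its atoms are over `S`. -/
def DLTGD.Over (S : Schema) (τ : DLTGD) : Prop :=
  Atom.Over S τ.1 ∧ τ.2 ≠ [] ∧ ∀ ρ ∈ τ.2, ρ ≠ [] ∧ ∀ A ∈ ρ, Atom.Over S A

/-- The query and the constraints of the input are over the schema of the input. -/
def Input.WellFormed (I : Input) : Prop :=
  BUCQ.Over I.2.2 I.1 ∧ ∀ τ ∈ I.2.1, DLTGD.Over I.2.2 τ

/-- No constant occurs in the atom. -/
def Atom.NoConst (A : Atom) : Prop :=
  ∀ c : ℕ, Sum.inr c ∉ A.2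

/-- No constant occurs in the query or in the constraints of the input. -/
def Input.NoConst (I : Input) : Prop :=
  (∀ q ∈ I.1, ∀ A ∈ q, Atom.NoConst A) ∧
    ∀ τ ∈ I.2.1, Atom.NoConst τ.1 ∧ ∀ ρ ∈ τ.2, ∀ A ∈ ρ, Atom.NoConst A

/-! ### Instances and satisfaction -/

/-- A fact: a relation name and a tuple of values. -/
abbrev Fact := ℕ × List ℕ

/-- The set of facts `F` is an instance of the schema `S` (it may be infinite): it assigns to
each relation of `S` a set of tuples of the associated arity. -/
def IsInstance (S : Schema) (F : Set Fact) : Prop :=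
  ∀ f ∈ F, ∃ r : RelDecl, S[f.1]? = some r ∧ f.2.length = r.2

/-- The relation named `R` is a visible relation of `S`. -/
def IsVisibleRel (S : Schema) (R : ℕ) : Prop :=
  ∃ n : ℕ, S[R]? = some (true, n)

/-- The visible part of an instance: its restriction to the visible relations. -/
def visiblePart (S : Schema) (F : Set Fact) : Set Fact :=
  {f ∈ F | IsVisibleRel S f.1}

/-- `V` is an instance of the visible subschema of `S`. -/
def IsVisibleInstance (S : Schema) (V : Set Fact) : Prop :=
  IsInstance S V ∧ ∀ f ∈ V, IsVisibleRel S f.1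

/-- The value of a term under an assignment of values to the variables. -/
def Trm.eval (ν : ℕ → ℕ) : Trm → ℕ
  | Sum.inl x => ν x
  | Sum.inr c => c

/-- The atom holds in `F` under the assignment `ν`. -/
def Atom.Holds (F : Set Fact) (ν : ℕ → ℕ) (A : Atom) : Prop :=
  (A.1, A.2.map (Trm.eval ν)) ∈ F

/-- The Boolean UCQ is true in `F`. -/
def BUCQ.Holds (F : Set Fact) (Q : BUCQ) : Prop :=
  ∃ q ∈ Q, ∃ ν : ℕ → ℕ, ∀ A ∈ q, Atom.Holds F ν A

/-- The disjunctive linear TGD is true in `F`. -/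
def DLTGD.Holds (F : Set Fact) (τ : DLTGD) : Prop :=
  ∀ ν : ℕ → ℕ, Atom.Holds F ν τ.1 →
    ∃ ν' : ℕ → ℕ, (∀ x : ℕ, Sum.inl x ∈ τ.1.2 → ν' x = ν x) ∧
      ∃ ρ ∈ τ.2, ∀ A ∈ ρ, Atom.Holds F ν' A

/-! ### Query implication

The predicate `K` says which instances are quantified over: `FiniteInst` for finite instances,
`AnyInst` for arbitrary (finite or infinite) ones. -/

/-- `F` is an instance of `S` in the class `K` that satisfies the constraints `C` and whose
visible part is `V`. -/
def IsRealization (K : Set Fact → Prop) (C : List DLTGD) (S : Schema) (V F : Set Fact) : Prop :=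
  IsInstance S F ∧ K F ∧ (∀ τ ∈ C, DLTGD.Holds F τ) ∧ visiblePart S F = V

/-- `V` is realizable with respect to the constraints. -/
def Realizable (K : Set Fact → Prop) (C : List DLTGD) (S : Schema) (V : Set Fact) : Prop :=
  ∃ F : Set Fact, IsRealization K C S V F

/-- Positive query implication: every instance that satisfies the constraints and has visible
part `V` satisfies the query. -/
def PQI (K : Set Fact → Prop) (Q : BUCQ) (C : List DLTGD) (S : Schema) (V : Set Fact) : Prop :=
  ∀ F : Set Fact, IsRealization K C S V F → BUCQ.Holds F Q

/-- The schema-level problem: some realizable instance of the visible schema admits a positive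
query implication. -/
def ExistsPQI (K : Set Fact → Prop) (I : Input) : Prop :=
  ∃ V : Set Fact, IsVisibleInstance I.2.2 V ∧ K V ∧
    Realizable K I.2.1 I.2.2 V ∧ PQI K I.1 I.2.1 I.2.2 V

/-- The class of finite instances. -/
def FiniteInst (F : Set Fact) : Prop := F.Finite

/-- The class of all (finite or infinite) instances. -/
def AnyInst (_ : Set Fact) : Prop := True

/-! ### Undecidability -/

/-- The problem `P`, with inputs ranging over `D`, is undecidable: no computable function
gives the right answer on all inputs in `D` (whatever it does outside `D`). -/
def UndecidableOn {α : Type*} [Primcodable α] (D P : α → Prop) : Prop :=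
  ¬ ∃ f : α → Bool, Computable f ∧ ∀ a : α, D a → (f a = true ↔ P a)

end HiddenQI

namespace HiddenQI

/-! ### From satisfiability of tuple generating dependencies to positive query implication -/

/-! Two reductions are composed. The first shows that positive query implication expresses
satisfiability of dependencies with arbitrary conjunctive bodies, although the only constraint has a
nullary atom as its body. That constraint says that a visible proposition "start" implies: the
hidden proposition "ok", or a forbidden visible pattern, or, for some dependency j, a hidden claim
H_j(x) together with a match of the body of j with shared values x. The query says "ok", or H_j(x)
together with a match of the head of j at x. If V contains "start", satisfies the dependencies and
avoids the pattern, then every claim is answered by a head, so the query is implied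
(`existsPQI_of_model`). Conversely, V without hidden facts falsifies the query, hence must violate
the constraint; and adding a single claim H_j(x) for a body match satisfies the constraint, so the
query forces the head at x (`model_of_existsPQI`).

The second reduction lets dependencies evaluate a code of a partial recursive function at `[n]`, the
forbidden pattern being a result with nonzero head. Every model, finite or not, represents the
result of a terminating evaluation (`exists_res_of_call`), so a nonzero head excludes all admissible
models. If the head is zero, the facts of a finite trace form a finite admissible model
(`stdFact_sat`).

Nothing is claimed about divergent evaluations, and nothing is needed: zero and nonzero results of
the diagonal function are recursively inseparable. A decider would yield a total 0/1-valued function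
whose value at its own index contradicts the decider's answer. Since one case produces a finite
model and the other excludes models of any size, the argument covers finite and unrestricted
instances alike. -/

/-- An atom without constants, given by its relation name and its variables. -/
def varAtom (R : ℕ) (xs : List ℕ) : Atom := (R, xs.map Sum.inl)

theorem varAtom_holds {F : Set Fact} {ν : ℕ → ℕ} {R : ℕ} {xs : List ℕ} :
    Atom.Holds F ν (varAtom R xs) ↔ (R, xs.map ν) ∈ F := by
  simp [Atom.Holds, varAtom, Function.comp_def, Trm.eval]

theorem varAtom_noConst (R : ℕ) (xs : List ℕ) : Atom.NoConst (varAtom R xs) := by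
  simp [Atom.NoConst, varAtom]

theorem Atom.Holds.mono {F G : Set Fact} (h : F ⊆ G) {ν : ℕ → ℕ} {A : Atom}
    (hA : Atom.Holds F ν A) : Atom.Holds G ν A := h hA

/-- A tuple generating dependency, with an arbitrary conjunction as its body; `front` lists the
variables shared by the body and the head. -/
structure TGD where
  /-- the body -/
  body : List Atom
  /-- the shared variables -/
  front : List ℕ
  /-- the head -/
  head : List Atom

/-- The dependency is true in `V`. -/
def TGD.Sat (V : Set Fact) (r : TGD) : Prop :=
  ∀ ν : ℕ → ℕ, (∀ A ∈ r.body, Atom.Holds V ν A) →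
    ∃ ν' : ℕ → ℕ, (∀ x ∈ r.front, ν' x = ν x) ∧ ∀ A ∈ r.head, Atom.Holds V ν' A

/-- The atom is constant-free and uses one of the first `B` relation names, with arities given by
`ar`. -/
def Atom.Fits (B : ℕ) (ar : ℕ → ℕ) (A : Atom) : Prop :=
  A.1 < B ∧ A.2.length = ar A.1 ∧ Atom.NoConst A

/-- All atoms of the dependency fit. -/
def TGD.Fits (B : ℕ) (ar : ℕ → ℕ) (r : TGD) : Prop :=
  (∀ A ∈ r.body, Atom.Fits B ar A) ∧ ∀ A ∈ r.head, Atom.Fits B ar A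

/-- Visible relations `0, …, B - 1`, the hidden proposition `B`, and for each dependency a hidden
relation over its shared variables. -/
def tgdSchema (B : ℕ) (ar : ℕ → ℕ) (rs : List TGD) : Schema :=
  (List.range B).map (fun i => (true, ar i)) ++
    (false, 0) :: rs.map (fun r => (false, r.front.length))

/-- The query: the hidden proposition holds, or a claimed violation of a dependency is none. -/
def tgdQuery (B : ℕ) (rs : List TGD) : BUCQ :=
  [(B, [])] :: rs.mapIdx fun j r => varAtom (B + 1 + j) r.front :: r.head

/-- The constraint: the hidden proposition holds, or the pattern `bad` occurs, or a violation of
some dependency is claimed. -/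
def tgdConstraint (B : ℕ) (bad : List Atom) (rs : List TGD) : DLTGD :=
  ((0, []), [(B, [])] :: bad ::
    rs.mapIdx fun j r => varAtom (B + 1 + j) r.front :: r.body)

/-- The input made from the dependencies `rs` and the forbidden pattern `bad`. -/
def tgdInput (B : ℕ) (ar : ℕ → ℕ) (bad : List Atom) (rs : List TGD) : Input :=
  (tgdQuery B rs, [tgdConstraint B bad rs], tgdSchema B ar rs)

section

variable {B : ℕ} {ar : ℕ → ℕ} {bad : List Atom} {rs : List TGD}

theorem tgdSchema_visible {i : ℕ} (h : i < B) :
    (tgdSchema B ar rs)[i]? = some (true, ar i) := by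
  simp [tgdSchema, List.getElem?_append, h]

theorem tgdSchema_ok : (tgdSchema B ar rs)[B]? = some (false, 0) := by
  simp [tgdSchema]

theorem tgdSchema_hidden {j : ℕ} (h : j < rs.length) :
    (tgdSchema B ar rs)[B + 1 + j]? = some (false, rs[j].front.length) := by
  have : B + 1 + j - B = j + 1 := by omega
  rw [tgdSchema, List.getElem?_append_right (by simp; omega)]
  simp [this, h]

theorem isVisibleRel_tgdSchema {R : ℕ} : IsVisibleRel (tgdSchema B ar rs) R ↔ R < B := by
  constructor
  · rintro ⟨n, hn⟩
    by_contra hR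
    rw [tgdSchema, List.getElem?_append_right (by simpa using hR)] at hn
    have := List.mem_of_getElem? hn
    simp at this
  · exact fun h => ⟨_, tgdSchema_visible h⟩

theorem Atom.Fits.over {A : Atom} (h : Atom.Fits B ar A) : Atom.Over (tgdSchema B ar rs) A :=
  ⟨_, tgdSchema_visible h.1, h.2.1⟩

theorem over_hidden {j : ℕ} (h : j < rs.length) :
    Atom.Over (tgdSchema B ar rs) (varAtom (B + 1 + j) rs[j].front) :=
  ⟨_, tgdSchema_hidden h, by simp [varAtom]⟩

theorem over_ok : Atom.Over (tgdSchema B ar rs) (B, []) := ⟨_, tgdSchema_ok, rfl⟩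

theorem tgdInput_wellFormed (h0 : 0 < B) (har : ar 0 = 0) (hbad : bad ≠ [])
    (hb : ∀ A ∈ bad, Atom.Fits B ar A) (hr : ∀ r ∈ rs, r.Fits B ar) :
    Input.WellFormed (tgdInput B ar bad rs) ∧ Input.NoConst (tgdInput B ar bad rs) := by
  have hnil : ∀ R : ℕ, Atom.NoConst (R, []) := fun R c => by simp
  refine ⟨⟨⟨by simp [tgdInput, tgdQuery], ?_⟩, ?_⟩, ?_, ?_⟩
  · intro q hq
    simp only [tgdInput, tgdQuery, List.mem_cons, List.mem_mapIdx] at hq ⊢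
    rcases hq with rfl | ⟨j, hj, rfl⟩
    · simpa using over_ok
    · refine ⟨by simp, fun A hA => ?_⟩
      rcases List.mem_cons.1 hA with rfl | hA
      · exact over_hidden hj
      · exact ((hr _ (List.getElem_mem hj)).2 A hA).over
  · intro τ hτ
    obtain rfl : τ = tgdConstraint B bad rs := by simpa [tgdInput] using hτ
    refine ⟨⟨_, tgdSchema_visible h0, by simp [tgdConstraint, har]⟩, by simp [tgdConstraint], ?_⟩
    intro q hq
    simp only [tgdInput, tgdConstraint, List.mem_cons, List.mem_mapIdx] at hq ⊢
    rcases hq with rfl | rfl | ⟨j, hj, rfl⟩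
    · simpa using over_ok
    · exact ⟨hbad, fun A hA => (hb A hA).over⟩
    · refine ⟨by simp, fun A hA => ?_⟩
      rcases List.mem_cons.1 hA with rfl | hA
      · exact over_hidden hj
      · exact ((hr _ (List.getElem_mem hj)).1 A hA).over
  · intro q hq
    simp only [tgdInput, tgdQuery, List.mem_cons, List.mem_mapIdx] at hq
    rcases hq with rfl | ⟨j, hj, rfl⟩
    · simpa using hnil B
    · intro A hA
      rcases List.mem_cons.1 hA with rfl | hA
      · exact varAtom_noConst _ _
      · exact ((hr _ (List.getElem_mem hj)).2 A hA).2.2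
  · intro τ hτ
    obtain rfl : τ = tgdConstraint B bad rs := by simpa [tgdInput] using hτ
    refine ⟨hnil 0, ?_⟩
    intro q hq
    simp only [tgdConstraint, List.mem_cons, List.mem_mapIdx] at hq
    rcases hq with rfl | rfl | ⟨j, hj, rfl⟩
    · simpa using hnil B
    · exact fun A hA => (hb A hA).2.2
    · intro A hA
      rcases List.mem_cons.1 hA with rfl | hA
      · exact varAtom_noConst _ _
      · exact ((hr _ (List.getElem_mem hj)).1 A hA).2.2

theorem visiblePart_insert {V : Set Fact} (hV : ∀ f ∈ V, f.1 < B) {f : Fact} (hf : B ≤ f.1) :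
    visiblePart (tgdSchema B ar rs) (insert f V) = V := by
  ext g
  simp only [visiblePart, isVisibleRel_tgdSchema, Set.mem_ofPred_eq, Set.mem_insert_iff]
  constructor
  · rintro ⟨rfl | h, h'⟩
    · omega
    · exact h
  · exact fun h => ⟨Or.inr h, hV g h⟩

theorem visiblePart_self {V : Set Fact} (hV : ∀ f ∈ V, f.1 < B) :
    visiblePart (tgdSchema B ar rs) V = V := by
  ext g
  simp only [visiblePart, isVisibleRel_tgdSchema, Set.mem_ofPred_eq]
  exact ⟨fun h => h.1, fun h => ⟨h, hV g h⟩⟩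

/-- A visible model of the dependencies that avoids the forbidden pattern admits a positive query
implication. -/
theorem existsPQI_of_model {K : Set Fact → Prop} {V : Set Fact}
    (hb : ∀ A ∈ bad, Atom.Fits B ar A) (hr : ∀ r ∈ rs, r.Fits B ar)
    (hV : ∀ f ∈ V, f.1 < B ∧ f.2.length = ar f.1) (hK : K V) (hK' : K (insert (B, []) V))
    (h0 : (0, []) ∈ V) (hsat : ∀ r ∈ rs, r.Sat V)
    (hnb : ¬ ∃ ν : ℕ → ℕ, ∀ A ∈ bad, Atom.Holds V ν A) :
    ExistsPQI K (tgdInput B ar bad rs) := by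
  have hVS : IsInstance (tgdSchema B ar rs) V := fun f hf =>
    ⟨_, tgdSchema_visible (hV f hf).1, (hV f hf).2⟩
  -- Adding the hidden proposition `B` makes the first disjunct of the constraint true, so `V` is
  -- realizable.
  refine ⟨V, ⟨hVS, fun f hf => isVisibleRel_tgdSchema.2 (hV f hf).1⟩, hK,
    ⟨insert (B, []) V, ?_, hK', ?_, visiblePart_insert (fun f hf => (hV f hf).1) le_rfl⟩, ?_⟩
  · rintro f (rfl | hf)
    · exact ⟨_, tgdSchema_ok, rfl⟩
    · exact hVS f hf
  · intro τ hτ ν _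
    obtain rfl : τ = tgdConstraint B bad rs := by simpa [tgdInput] using hτ
    exact ⟨ν, fun _ _ => rfl, [(B, [])], by simp [tgdConstraint], by simp [Atom.Holds]⟩
  · rintro F ⟨_, _, hC, hF⟩
    have hVF : V ⊆ F := by rw [← hF]; exact fun f hf => hf.1
    have hvis : ∀ (ν : ℕ → ℕ) (A : Atom), Atom.Fits B ar A → Atom.Holds F ν A →
        Atom.Holds V ν A := by
      intro ν A hA h
      rw [← hF]
      exact ⟨h, isVisibleRel_tgdSchema.2 hA.1⟩
    obtain ⟨ν, -, q, hq, hqF⟩ := hC (tgdConstraint B bad rs) (by simp [tgdInput]) (fun _ => 0)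
      (hVF h0)
    simp only [tgdConstraint, List.mem_cons, List.mem_mapIdx] at hq
    rcases hq with rfl | rfl | ⟨j, hj, rfl⟩
    · exact ⟨_, List.mem_cons_self .., ν, hqF⟩
    · exact absurd ⟨ν, fun A hA => hvis ν A (hb A hA) (hqF A hA)⟩ hnb
    -- The body atoms are visible, so the match lies in `V`; the head found there has the same
    -- shared values, hence fits the same hidden claim.
    · obtain ⟨ν', hfr, hh⟩ := hsat _ (List.getElem_mem hj) ν fun A hA =>
        hvis ν A ((hr _ (List.getElem_mem hj)).1 A hA) (hqF A (List.mem_cons_of_mem _ hA))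
      refine ⟨_, List.mem_cons_of_mem _ (List.mem_mapIdx.2 ⟨j, hj, rfl⟩), ν', fun A hA => ?_⟩
      rcases List.mem_cons.1 hA with rfl | hA
      · have := hqF _ (List.mem_cons_self ..)
        rw [varAtom_holds] at this ⊢
        rwa [List.map_congr_left hfr]
      · exact (hh A hA).mono hVF

/-- Conversely, an instance that admits a positive query implication is a visible model of the
dependencies that avoids the forbidden pattern. -/
theorem model_of_existsPQI {K : Set Fact → Prop} (hK : ∀ V f, K V → K (insert f V))
    (hr : ∀ r ∈ rs, r.Fits B ar) (h : ExistsPQI K (tgdInput B ar bad rs)) :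
    ∃ V : Set Fact, (0, []) ∈ V ∧ (∀ r ∈ rs, r.Sat V) ∧
      ¬ ∃ ν : ℕ → ℕ, ∀ A ∈ bad, Atom.Holds V ν A := by
  obtain ⟨V, ⟨hVS, hVv⟩, hKV, -, hQ⟩ := h
  have hV : ∀ f ∈ V, f.1 < B := fun f hf => isVisibleRel_tgdSchema.1 (hVv f hf)
  -- Every disjunct of the query contains a hidden atom, so `V` itself falsifies the query and
  -- cannot be one of its own realizations.
  have hself : ¬ DLTGD.Holds V (tgdConstraint B bad rs) := by
    intro hC
    obtain ⟨q, hq, ν, hν⟩ := hQ V ⟨hVS, hKV, by simpa [tgdInput] using hC, visiblePart_self hV⟩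
    simp only [tgdInput, tgdQuery, List.mem_cons, List.mem_mapIdx] at hq
    rcases hq with rfl | ⟨j, hj, rfl⟩
    · have := hV _ (hν _ (List.mem_cons_self ..))
      simp at this
    · have := hV _ (hν _ (List.mem_cons_self ..))
      simp [varAtom] at this
      omega
  refine ⟨V, ?_, ?_, ?_⟩
  · by_contra h0
    exact hself fun ν hν => absurd hν h0
  · intro r hrs ν hbody
    obtain ⟨j, hj, rfl⟩ := List.mem_iff_getElem.1 hrs
    -- The only hidden fact added is the claim that dependency `j` is violated at the shared values
    -- of `ν`.
    set f : Fact := (B + 1 + j, rs[j].front.map ν) with hf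
    have hins : ∀ {A : Atom} {μ : ℕ → ℕ}, Atom.Holds (insert f V) μ A → B ≤ A.1 →
        A.1 = B + 1 + j ∧ A.2.map (Trm.eval μ) = rs[j].front.map ν := by
      rintro A μ (h | h) hA
      · exact Prod.ext_iff.1 h
      · exact absurd (hV _ h) (by simpa using hA)
    have hF : IsRealization K (tgdInput B ar bad rs).2.1 (tgdSchema B ar rs) V (insert f V) := by
      refine ⟨?_, hK _ _ hKV, ?_, visiblePart_insert hV (by simp [hf]; omega)⟩
      · rintro g (rfl | hg)
        · exact ⟨_, tgdSchema_hidden hj, by simp [hf]⟩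
        · exact hVS g hg
      · intro τ hτ ν₀ _
        obtain rfl : τ = tgdConstraint B bad rs := by simpa [tgdInput] using hτ
        refine ⟨ν, fun x hx => by simp [tgdConstraint] at hx, varAtom (B + 1 + j) rs[j].front ::
          rs[j].body, ?_, fun A hA => ?_⟩
        · simp only [tgdConstraint, List.mem_cons, List.mem_mapIdx]
          exact Or.inr (Or.inr ⟨j, hj, rfl⟩)
        · rcases List.mem_cons.1 hA with rfl | hA
          · exact varAtom_holds.2 (Or.inl rfl)
          · exact (hbody A hA).mono (Set.subset_insert _ _)
    obtain ⟨q, hq, μ, hμ⟩ := hQ (insert f V) hF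
    simp only [tgdInput, tgdQuery, List.mem_cons, List.mem_mapIdx] at hq
    rcases hq with rfl | ⟨i, hi, rfl⟩
    · have := (hins (hμ _ (List.mem_cons_self ..)) le_rfl).1
      simp at this
      omega
    -- The query can only use the claim `f`, which identifies the dependency and its shared values;
    -- the head atoms are visible, so they hold already in `V`.
    · obtain ⟨h1, h2⟩ := hins (hμ _ (List.mem_cons_self ..)) (by simp [varAtom]; omega)
      obtain rfl : i = j := by simpa [varAtom] using h1
      refine ⟨μ, ?_, fun A hA => ?_⟩
      · simpa [varAtom, Function.comp_def, Trm.eval] using h2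
      · rcases hμ A (List.mem_cons_of_mem _ hA) with h | h
        · have h3 := ((hr _ hrs).2 A hA).1
          have h4 : A.1 = B + 1 + i := congrArg Prod.fst h
          omega
        · exact h
  · rintro ⟨ν, hν⟩
    exact hself fun ν₀ _ => ⟨ν, fun x hx => by simp [tgdConstraint] at hx, bad,
      by simp [tgdConstraint], hν⟩

end

open Turing.ToPartrec (Code)

/-! ### Simulating partial recursive functions by dependencies

Natural numbers are represented by chains of the relation `2` (successor) that start in the
relation `1` (zero), and lists by the relation `3` (head, tail, list), where an element that has
head zero and is its own tail represents the empty list. Every code `c` has a relation for the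
arguments it is called on and a relation for its results. -/

/-- All codes that occur in a code. -/
def subcodes : Code → List Code
  | .cons f g => .cons f g :: (subcodes f ++ subcodes g)
  | .comp f g => .comp f g :: (subcodes f ++ subcodes g)
  | .case f g => .case f g :: (subcodes f ++ subcodes g)
  | .fix f => .fix f :: subcodes f
  | c => [c]

theorem mem_subcodes_self (c : Code) : c ∈ subcodes c := by
  cases c <;> simp [subcodes]

theorem subcodes_subset {c d : Code} (h : d ∈ subcodes c) : subcodes d ⊆ subcodes c := by
  induction c with
  | zero' | succ | tail =>
    simp only [subcodes, List.mem_singleton] at h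
    rw [h]; simp [subcodes]
  | cons f g ihf ihg | comp f g ihf ihg | case f g ihf ihg =>
    simp only [subcodes, List.mem_cons, List.mem_append] at h
    rcases h with rfl | h | h
    · exact List.Subset.refl _
    · exact List.Subset.trans (ihf h) (by simp [subcodes])
    · exact List.Subset.trans (ihg h) (by simp [subcodes])
  | fix f ihf =>
    simp only [subcodes, List.mem_cons] at h
    rcases h with rfl | h
    · exact List.Subset.refl _
    · exact List.Subset.trans (ihf h) (by simp [subcodes])

/-! ### Unfolding the evaluation of codes -/

section Eval

variable {f g : Code} {v w : List ℕ}

theorem mem_eval_cons : w ∈ (Code.cons f g).eval v ↔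
    ∃ a ∈ f.eval v, ∃ b ∈ g.eval v, w = a.headI :: b := by
  simp [Part.pure_eq_some]

theorem mem_eval_comp : w ∈ (Code.comp f g).eval v ↔ ∃ u ∈ g.eval v, w ∈ f.eval u := by
  rw [Code.comp_eval]
  exact Part.mem_bind_iff

theorem eval_case_zero (h : v.headI = 0) : (Code.case f g).eval v = f.eval v.tail := by
  simp [h]

theorem eval_case_succ {n : ℕ} (h : v.headI = n + 1) :
    (Code.case f g).eval v = g.eval (n :: v.tail) := by
  simp [h]

/-- One turn of the loop: a zero head stops it and a nonzero head restarts it on the tail. The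
dependencies for `fix` mirror these two cases. -/
theorem mem_eval_fix : w ∈ (Code.fix f).eval v ↔ ∃ u ∈ f.eval v,
    (u.headI = 0 ∧ w = u.tail) ∨ (u.headI ≠ 0 ∧ w ∈ (Code.fix f).eval u.tail) := by
  rw [Code.fix_eval]
  refine PFun.mem_fix_iff.trans ?_
  constructor
  · rintro (h | ⟨a, h, hw⟩)
    · obtain ⟨u, hu, h⟩ := (Part.mem_map_iff _).1 h
      split_ifs at h with h0
      cases h
      exact ⟨u, hu, Or.inl ⟨h0, rfl⟩⟩
    · obtain ⟨u, hu, h⟩ := (Part.mem_map_iff _).1 h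
      split_ifs at h with h0
      cases h
      exact ⟨u, hu, Or.inr ⟨h0, hw⟩⟩
  · rintro ⟨u, hu, ⟨h0, rfl⟩ | ⟨h0, hw⟩⟩
    · exact Or.inl ((Part.mem_map_iff _).2 ⟨u, hu, by simp [h0]⟩)
    · exact Or.inr ⟨_, (Part.mem_map_iff _).2 ⟨u, hu, by simp [h0]⟩, hw⟩

/-- Induction along a terminating iteration of `f`. -/
theorem fix_induction {P : List ℕ → Prop} (hw : w ∈ (Code.fix f).eval v)
    (H : ∀ v u, u ∈ f.eval v → w ∈ (Code.fix f).eval v →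
      (u.headI ≠ 0 → w ∈ (Code.fix f).eval u.tail ∧ P u.tail) → P v) : P v := by
  have hw' := hw
  rw [Code.fix_eval] at hw
  refine PFun.fixInduction (C := fun v => w ∈ (Code.fix f).eval v → P v) hw ?_ hw'
  intro v' _ ih hv'
  obtain ⟨u, hu, h⟩ := mem_eval_fix.1 hv'
  refine H v' u hu hv' fun h0 => ?_
  obtain ⟨h0', -⟩ | ⟨-, h⟩ := h
  · exact absurd h0' h0
  · exact ⟨h, ih _ ((Part.mem_map_iff _).2 ⟨u, hu, by simp [h0]⟩) h⟩

end Eval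

/-! ### Finite traces of terminating evaluations -/

/-- The evaluations that the evaluation of `c` at `v` calls directly. -/
def calls : Code → List ℕ → Set (Code × List ℕ)
  | .cons f g, v => {(f, v), (g, v)}
  | .comp f g, v => insert (g, v) {p | p.1 = f ∧ p.2 ∈ g.eval v}
  | .case f g, v => {v.headI.rec (f, v.tail) fun n _ => (g, n :: v.tail)}
  | .fix f, v => insert (f, v) {p | p.1 = .fix f ∧ ∃ u ∈ f.eval v, u.headI ≠ 0 ∧ p.2 = u.tail}
  | _, _ => ∅

/-- The set of evaluations is closed under calls, consists of terminating evaluations of codes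
in `L`, and is finite. -/
structure IsTrace (L : List Code) (T : Set (Code × List ℕ)) : Prop where
  finite : T.Finite
  dom : ∀ p ∈ T, (p.1.eval p.2).Dom
  mem : ∀ p ∈ T, p.1 ∈ L
  closed : ∀ p ∈ T, calls p.1 p.2 ⊆ T

theorem IsTrace.union {L : List Code} {T U : Set (Code × List ℕ)} (hT : IsTrace L T)
    (hU : IsTrace L U) : IsTrace L (T ∪ U) where
  finite := hT.finite.union hU.finite
  dom p hp := hp.elim (hT.dom p) (hU.dom p)
  mem p hp := hp.elim (hT.mem p) (hU.mem p)
  closed p hp := hp.elim (fun h => (hT.closed p h).trans Set.subset_union_left)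
    (fun h => (hU.closed p h).trans Set.subset_union_right)

theorem IsTrace.insert {L : List Code} {T : Set (Code × List ℕ)} (hT : IsTrace L T) {c : Code}
    {v : List ℕ} (hd : (c.eval v).Dom) (hc : c ∈ L) (hT' : calls c v ⊆ T) :
    IsTrace L (insert (c, v) T) where
  finite := hT.finite.insert _
  dom := by
    rintro p (rfl | hp)
    exacts [hd, hT.dom p hp]
  mem := by
    rintro p (rfl | hp)
    exacts [hc, hT.mem p hp]
  closed := by
    rintro p (rfl | hp)
    exacts [hT'.trans (Set.subset_insert _ _), (hT.closed p hp).trans (Set.subset_insert _ _)]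

theorem isTrace_empty (L : List Code) : IsTrace L ∅ := ⟨Set.finite_empty, by simp, by simp, by simp⟩

/-- A terminating evaluation has a finite trace. -/
theorem exists_isTrace {L : List Code} {c : Code} (hL : subcodes c ⊆ L) {v w : List ℕ}
    (hw : w ∈ c.eval v) : ∃ T, IsTrace L T ∧ (c, v) ∈ T := by
  induction c generalizing v w with
  | zero' | succ | tail =>
    exact ⟨_, (isTrace_empty L).insert (Part.dom_iff_mem.2 ⟨w, hw⟩) (hL (mem_subcodes_self _))
      (by simp [calls]), Set.mem_insert _ _⟩
  | cons f g ihf ihg =>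
    obtain ⟨a, ha, b, hb, -⟩ := mem_eval_cons.1 hw
    obtain ⟨T, hT, hfT⟩ := ihf (fun d hd => hL (by simp [subcodes, hd])) ha
    obtain ⟨U, hU, hgU⟩ := ihg (fun d hd => hL (by simp [subcodes, hd])) hb
    refine ⟨_, (hT.union hU).insert (Part.dom_iff_mem.2 ⟨w, hw⟩) (hL (mem_subcodes_self _)) ?_,
      Set.mem_insert _ _⟩
    rintro p (rfl | rfl)
    exacts [Or.inl hfT, Or.inr hgU]
  | comp f g ihf ihg =>
    obtain ⟨a, ha, hb⟩ := mem_eval_comp.1 hw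
    obtain ⟨T, hT, hfT⟩ := ihf (fun d hd => hL (by simp [subcodes, hd])) hb
    obtain ⟨U, hU, hgU⟩ := ihg (fun d hd => hL (by simp [subcodes, hd])) ha
    refine ⟨_, (hT.union hU).insert (Part.dom_iff_mem.2 ⟨w, hw⟩) (hL (mem_subcodes_self _)) ?_,
      Set.mem_insert _ _⟩
    rintro ⟨c, u⟩ (h | ⟨h1, h2⟩)
    · exact Or.inr (h ▸ hgU)
    -- Evaluation is single-valued, so `f` is called only on the value `a` already traced.
    · obtain rfl : u = a := Part.mem_unique h2 ha
      obtain rfl : c = f := h1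
      exact Or.inl hfT
  | case f g ihf ihg =>
    rcases hv : v.headI with _ | n
    · rw [eval_case_zero hv] at hw
      obtain ⟨T, hT, hfT⟩ := ihf (fun d hd => hL (by simp [subcodes, hd])) hw
      refine ⟨_, hT.insert (c := .case f g) (v := v) ?_ (hL (mem_subcodes_self _)) ?_,
        Set.mem_insert _ _⟩
      · rw [eval_case_zero hv]; exact Part.dom_iff_mem.2 ⟨w, hw⟩
      · simpa [calls, hv] using hfT
    · rw [eval_case_succ hv] at hw
      obtain ⟨T, hT, hfT⟩ := ihg (fun d hd => hL (by simp [subcodes, hd])) hw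
      refine ⟨_, hT.insert (c := .case f g) (v := v) ?_ (hL (mem_subcodes_self _)) ?_,
        Set.mem_insert _ _⟩
      · rw [eval_case_succ hv]; exact Part.dom_iff_mem.2 ⟨w, hw⟩
      · simpa [calls, hv] using hfT
  | fix f ihf =>
    -- A loop calls itself, so structural induction on the code does not suffice; an inner induction
    -- follows its iterations.
    refine fix_induction (P := fun v => ∃ T, IsTrace L T ∧ (Code.fix f, v) ∈ T) hw ?_
    intro v u hu hwv ih
    obtain ⟨T, hT, hfT⟩ := ihf (fun d hd => hL (by simp [subcodes, hd])) hu
    have hd := Part.dom_iff_mem.2 ⟨w, hwv⟩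
    by_cases h0 : u.headI = 0
    · refine ⟨_, hT.insert hd (hL (mem_subcodes_self _)) ?_, Set.mem_insert _ _⟩
      rintro ⟨c, x⟩ (h | ⟨-, y, hy, hy0, -⟩)
      · exact h ▸ hfT
      · obtain rfl := Part.mem_unique hy hu
        exact absurd h0 hy0
    · obtain ⟨-, U, hU, hgU⟩ := ih h0
      refine ⟨_, (hT.union hU).insert hd (hL (mem_subcodes_self _)) ?_, Set.mem_insert _ _⟩
      rintro ⟨c, x⟩ (h | ⟨h1, y, hy, -, h2⟩)
      · exact Or.inl (h ▸ hfT)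
      · obtain rfl := Part.mem_unique hy hu
        obtain rfl : c = .fix f := h1
        obtain rfl : x = y.tail := h2
        exact Or.inr hgU

/-! ### Relations and dependencies attached to a code -/

/-- The relation of the arguments on which the code is called. -/
def callRel (L : List Code) (c : Code) : ℕ := 5 + 3 * L.idxOf c

/-- The relation between arguments and results of the code. -/
def resRel (L : List Code) (c : Code) : ℕ := 6 + 3 * L.idxOf c

/-- The relation between the arguments of a case distinction and those of its successor branch. -/
def auxRel (L : List Code) (c : Code) : ℕ := 7 + 3 * L.idxOf c

/-- The arities of the relations. -/
def relArity : ℕ → ℕ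
  | 0 => 0
  | 1 => 1
  | 2 => 2
  | 3 => 3
  | 4 => 1
  | R + 5 => if R % 3 = 0 then 1 else 2

/-- The dependencies that describe the evaluation of a code in terms of its parts. -/
def codeRules (L : List Code) (c : Code) : List TGD :=
  match c with
  | .zero' =>
    [⟨[varAtom (callRel L c) [0]], [0],
      [varAtom 1 [1], varAtom 3 [1, 0, 2], varAtom (resRel L c) [0, 2]]⟩]
  | .succ =>
    [⟨[varAtom (callRel L c) [0], varAtom 3 [1, 2, 0]], [0, 1],
      [varAtom 2 [1, 3], varAtom 1 [4], varAtom 3 [4, 5, 5], varAtom 3 [3, 5, 6],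
        varAtom (resRel L c) [0, 6]]⟩]
  | .tail =>
    [⟨[varAtom (callRel L c) [0], varAtom 3 [1, 2, 0]], [0, 2], [varAtom (resRel L c) [0, 2]]⟩]
  | .cons f g =>
    [⟨[varAtom (callRel L c) [0]], [0], [varAtom (callRel L f) [0], varAtom (callRel L g) [0]]⟩,
      ⟨[varAtom (callRel L c) [0], varAtom (resRel L f) [0, 1], varAtom (resRel L g) [0, 2],
        varAtom 3 [3, 4, 1]], [0, 2, 3], [varAtom 3 [3, 2, 5], varAtom (resRel L c) [0, 5]]⟩]
  | .comp f g =>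
    [⟨[varAtom (callRel L c) [0]], [0], [varAtom (callRel L g) [0]]⟩,
      ⟨[varAtom (callRel L c) [0], varAtom (resRel L g) [0, 1]], [1],
        [varAtom (callRel L f) [1]]⟩,
      ⟨[varAtom (callRel L c) [0], varAtom (resRel L g) [0, 1], varAtom (resRel L f) [1, 2]],
        [0, 2], [varAtom (resRel L c) [0, 2]]⟩]
  | .case f g =>
    [⟨[varAtom (callRel L c) [0], varAtom 3 [1, 2, 0], varAtom 1 [1]], [2],
        [varAtom (callRel L f) [2]]⟩,
      ⟨[varAtom (callRel L c) [0], varAtom 3 [1, 2, 0], varAtom 1 [1],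
        varAtom (resRel L f) [2, 3]], [0, 3], [varAtom (resRel L c) [0, 3]]⟩,
      ⟨[varAtom (callRel L c) [0], varAtom 3 [1, 2, 0], varAtom 2 [3, 1]], [0, 2, 3],
        [varAtom 3 [3, 2, 4], varAtom (auxRel L c) [0, 4], varAtom (callRel L g) [4]]⟩,
      ⟨[varAtom (auxRel L c) [0, 4], varAtom (resRel L g) [4, 5]], [0, 5],
        [varAtom (resRel L c) [0, 5]]⟩]
  | .fix f =>
    [⟨[varAtom (callRel L c) [0]], [0], [varAtom (callRel L f) [0]]⟩,
      ⟨[varAtom (callRel L c) [0], varAtom (resRel L f) [0, 1], varAtom 3 [2, 3, 1],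
        varAtom 1 [2]], [0, 3], [varAtom (resRel L c) [0, 3]]⟩,
      ⟨[varAtom (callRel L c) [0], varAtom (resRel L f) [0, 1], varAtom 3 [2, 3, 1],
        varAtom 2 [4, 2]], [3], [varAtom (callRel L c) [3]]⟩,
      ⟨[varAtom (callRel L c) [0], varAtom (resRel L f) [0, 1], varAtom 3 [2, 3, 1],
        varAtom 2 [4, 2], varAtom (resRel L c) [3, 5]], [0, 5], [varAtom (resRel L c) [0, 5]]⟩]

/-! ### Representation of results in arbitrary models -/

/-- The assignment that maps the variables `0, 1, …` to the members of the list. -/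
def assign (l : List ℕ) (i : ℕ) : ℕ := l.getD i 0

/-- The element `x` represents the number `k` in `V`. -/
def RepNat (V : Set Fact) : ℕ → ℕ → Prop
  | 0, x => (1, [x]) ∈ V
  | k + 1, x => ∃ y, RepNat V k y ∧ (2, [y, x]) ∈ V

/-- The element `x` represents the list `v` in `V`. -/
def RepList (V : Set Fact) : List ℕ → ℕ → Prop
  | [], x => ∃ z, (1, [z]) ∈ V ∧ (3, [z, x, x]) ∈ V
  | a :: v, x => ∃ h t, RepNat V a h ∧ RepList V v t ∧ (3, [h, t, x]) ∈ V

/-- The coding of the empty list by a self-loop agrees with the conventions `headI [] = 0` and `tail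
[] = []`, so no dependency has to test for emptiness. -/
theorem RepList.head_tail {V : Set Fact} {v : List ℕ} {x : ℕ} (h : RepList V v x) :
    ∃ y t, RepNat V v.headI y ∧ RepList V v.tail t ∧ (3, [y, t, x]) ∈ V := by
  cases v with
  | nil =>
    obtain ⟨z, hz, hx⟩ := h
    exact ⟨z, x, hz, ⟨z, hz, hx⟩, hx⟩
  | cons a v => exact h

/-- In every model of the dependencies, the results of terminating evaluations are present. -/
theorem exists_res_of_call {V : Set Fact} {L : List Code} {c : Code}
    (hs : ∀ d ∈ subcodes c, ∀ r ∈ codeRules L d, r.Sat V) {x : ℕ} {v w : List ℕ}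
    (hx : (callRel L c, [x]) ∈ V) (hv : RepList V v x) (hw : w ∈ c.eval v) :
    ∃ y, (resRel L c, [x, y]) ∈ V ∧ RepList V w y := by
  have h := hs c (mem_subcodes_self c)
  induction c generalizing x v w with
  | zero' =>
    obtain rfl : w = 0 :: v := by simpa [Part.pure_eq_some] using hw
    simp only [codeRules, TGD.Sat, List.forall_mem_cons, List.not_mem_nil, false_imp_iff,
      implies_true, and_true, varAtom_holds, List.map_cons, List.map_nil] at h
    -- The list gives the values of the body variables 0, 1, …; the new `ν` also interprets the
    -- existential variables and agrees with the old assignment on the shared ones.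
    obtain ⟨ν, e0, h1, h2, h3⟩ := h (assign [x]) hx
    replace e0 : ν 0 = x := e0
    rw [e0] at h2 h3
    exact ⟨_, h3, _, _, h1, hv, h2⟩
  | succ =>
    obtain rfl : w = [v.headI + 1] := by simpa [Part.pure_eq_some] using hw
    obtain ⟨y, t, hy, ht, hyt⟩ := hv.head_tail
    simp only [codeRules, TGD.Sat, List.forall_mem_cons, List.not_mem_nil, false_imp_iff,
      implies_true, and_true, varAtom_holds, List.map_cons, List.map_nil] at h
    obtain ⟨ν, ⟨e0, e1⟩, h1, h2, h3, h4, h5⟩ := h (assign [x, y, t]) ⟨hx, hyt⟩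
    replace e0 : ν 0 = x := e0
    replace e1 : ν 1 = y := e1
    rw [e0] at h5
    rw [e1] at h1
    exact ⟨_, h5, _, _, ⟨y, hy, h1⟩, ⟨_, h2, h3⟩, h4⟩
  | tail =>
    obtain rfl : w = v.tail := by simpa [Part.pure_eq_some] using hw
    obtain ⟨y, t, hy, ht, hyt⟩ := hv.head_tail
    simp only [codeRules, TGD.Sat, List.forall_mem_cons, List.not_mem_nil, false_imp_iff,
      implies_true, and_true, varAtom_holds, List.map_cons, List.map_nil] at h
    obtain ⟨ν, ⟨e0, e1⟩, h1⟩ := h (assign [x, y, t]) ⟨hx, hyt⟩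
    replace e0 : ν 0 = x := e0
    replace e1 : ν 2 = t := e1
    rw [e0, e1] at h1
    exact ⟨_, h1, ht⟩
  | cons f g ihf ihg =>
    obtain ⟨a, ha, b, hb, rfl⟩ := mem_eval_cons.1 hw
    have hsf : ∀ d ∈ subcodes f, ∀ r ∈ codeRules L d, r.Sat V :=
      fun d hd => hs d (by simp [subcodes, hd])
    have hsg : ∀ d ∈ subcodes g, ∀ r ∈ codeRules L d, r.Sat V :=
      fun d hd => hs d (by simp [subcodes, hd])
    simp only [codeRules, TGD.Sat, List.forall_mem_cons, List.not_mem_nil, false_imp_iff,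
      implies_true, and_true, varAtom_holds, List.map_cons, List.map_nil] at h
    obtain ⟨H1, H2⟩ := h
    obtain ⟨ν, e0, h1, h2⟩ := H1 (assign [x]) hx
    replace e0 : ν 0 = x := e0
    rw [e0] at h1 h2
    obtain ⟨y, hy, hay⟩ := ihf hsf h1 hv ha (hsf f (mem_subcodes_self f))
    obtain ⟨z, hz, hbz⟩ := ihg hsg h2 hv hb (hsg g (mem_subcodes_self g))
    obtain ⟨p, t, hp, ht, hpt⟩ := hay.head_tail
    obtain ⟨ν, ⟨e0, e2, e3⟩, h3, h4⟩ := H2 (assign [x, y, z, p, t]) ⟨hx, hy, hz, hpt⟩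
    replace e0 : ν 0 = x := e0
    replace e2 : ν 2 = z := e2
    replace e3 : ν 3 = p := e3
    rw [e2, e3] at h3
    rw [e0] at h4
    exact ⟨_, h4, p, z, hp, hbz, h3⟩
  | comp f g ihf ihg =>
    obtain ⟨a, ha, hb⟩ := mem_eval_comp.1 hw
    have hsf : ∀ d ∈ subcodes f, ∀ r ∈ codeRules L d, r.Sat V :=
      fun d hd => hs d (by simp [subcodes, hd])
    have hsg : ∀ d ∈ subcodes g, ∀ r ∈ codeRules L d, r.Sat V :=
      fun d hd => hs d (by simp [subcodes, hd])
    simp only [codeRules, TGD.Sat, List.forall_mem_cons, List.not_mem_nil, false_imp_iff,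
      implies_true, and_true, varAtom_holds, List.map_cons, List.map_nil] at h
    obtain ⟨H1, H2, H3⟩ := h
    obtain ⟨ν, e0, h1⟩ := H1 (assign [x]) hx
    replace e0 : ν 0 = x := e0
    rw [e0] at h1
    obtain ⟨y, hy, hay⟩ := ihg hsg h1 hv ha (hsg g (mem_subcodes_self g))
    obtain ⟨ν, e1, h2⟩ := H2 (assign [x, y]) ⟨hx, hy⟩
    replace e1 : ν 1 = y := e1
    rw [e1] at h2
    obtain ⟨z, hz, hbz⟩ := ihf hsf h2 hay hb (hsf f (mem_subcodes_self f))
    obtain ⟨ν, ⟨e0, e2⟩, h3⟩ := H3 (assign [x, y, z]) ⟨hx, hy, hz⟩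
    replace e0 : ν 0 = x := e0
    replace e2 : ν 2 = z := e2
    rw [e0, e2] at h3
    exact ⟨z, h3, hbz⟩
  | case f g ihf ihg =>
    have hsf : ∀ d ∈ subcodes f, ∀ r ∈ codeRules L d, r.Sat V :=
      fun d hd => hs d (by simp [subcodes, hd])
    have hsg : ∀ d ∈ subcodes g, ∀ r ∈ codeRules L d, r.Sat V :=
      fun d hd => hs d (by simp [subcodes, hd])
    simp only [codeRules, TGD.Sat, List.forall_mem_cons, List.not_mem_nil, false_imp_iff,
      implies_true, and_true, varAtom_holds, List.map_cons, List.map_nil] at h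
    obtain ⟨H1, H2, H3, H4⟩ := h
    obtain ⟨p, t, hp, ht, hpt⟩ := hv.head_tail
    rcases hn : v.headI with _ | n
    · rw [eval_case_zero hn] at hw
      rw [hn] at hp
      obtain ⟨ν, e2, h1⟩ := H1 (assign [x, p, t]) ⟨hx, hpt, hp⟩
      replace e2 : ν 2 = t := e2
      rw [e2] at h1
      obtain ⟨y, hy, hwy⟩ := ihf hsf h1 ht hw (hsf f (mem_subcodes_self f))
      obtain ⟨ν, ⟨e0, e3⟩, h2⟩ := H2 (assign [x, p, t, y]) ⟨hx, hpt, hp, hy⟩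
      replace e0 : ν 0 = x := e0
      replace e3 : ν 3 = y := e3
      rw [e0, e3] at h2
      exact ⟨y, h2, hwy⟩
    · rw [eval_case_succ hn] at hw
      rw [hn] at hp
      obtain ⟨q, hq, hqp⟩ := hp
      obtain ⟨ν, ⟨e0, e2, e3⟩, h1, h2, h3⟩ := H3 (assign [x, p, t, q]) ⟨hx, hpt, hqp⟩
      replace e0 : ν 0 = x := e0
      replace e2 : ν 2 = t := e2
      replace e3 : ν 3 = q := e3
      rw [e2, e3] at h1
      rw [e0] at h2
      obtain ⟨y, hy, hwy⟩ := ihg hsg (v := n :: v.tail) h3 ⟨q, t, hq, ht, h1⟩ hw (hsg g (mem_subcodes_self g))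
      -- Variable 4 is the element that the third dependency supplied for `n :: v.tail`.
      obtain ⟨ν', ⟨e0, e5⟩, h4⟩ := H4 (assign [x, p, t, q, ν 4, y]) ⟨h2, hy⟩
      replace e0 : ν' 0 = x := e0
      replace e5 : ν' 5 = y := e5
      rw [e0, e5] at h4
      exact ⟨y, h4, hwy⟩
  | fix f ihf =>
    have hsf : ∀ d ∈ subcodes f, ∀ r ∈ codeRules L d, r.Sat V :=
      fun d hd => hs d (by simp [subcodes, hd])
    simp only [codeRules, TGD.Sat, List.forall_mem_cons, List.not_mem_nil, false_imp_iff,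
      implies_true, and_true, varAtom_holds, List.map_cons, List.map_nil] at h
    obtain ⟨H1, H2, H3, H4⟩ := h
    -- The element `x` is quantified inside the motive because each iteration moves to the element
    -- of a new argument.
    refine fix_induction (P := fun v => ∀ x, (callRel L (.fix f), [x]) ∈ V → RepList V v x →
      ∃ y, (resRel L (.fix f), [x, y]) ∈ V ∧ RepList V w y) hw ?_ x hx hv
    clear hw hv hx v x
    intro v u hu hwv ih x hx hv
    obtain ⟨ν, e0, h1⟩ := H1 (assign [x]) hx
    replace e0 : ν 0 = x := e0
    rw [e0] at h1
    obtain ⟨y, hy, huy⟩ := ihf hsf h1 hv hu (hsf f (mem_subcodes_self f))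
    obtain ⟨p, t, hp, ht, hpt⟩ := huy.head_tail
    rcases hn : u.headI with _ | n
    · obtain ⟨u', hu', ⟨-, rfl⟩ | ⟨h0, -⟩⟩ := mem_eval_fix.1 hwv <;>
        obtain rfl := Part.mem_unique hu' hu
      · rw [hn] at hp
        obtain ⟨ν, ⟨e0, e3⟩, h2⟩ := H2 (assign [x, y, p, t]) ⟨hx, hy, hpt, hp⟩
        replace e0 : ν 0 = x := e0
        replace e3 : ν 3 = t := e3
        rw [e0, e3] at h2
        exact ⟨t, h2, ht⟩
      · exact absurd hn h0
    · rw [hn] at hp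
      obtain ⟨q, hq, hqp⟩ := hp
      obtain ⟨ν, e3, h2⟩ := H3 (assign [x, y, p, t, q]) ⟨hx, hy, hpt, hqp⟩
      replace e3 : ν 3 = t := e3
      rw [e3] at h2
      obtain ⟨-, ih⟩ := ih (by omega)
      obtain ⟨z, hz, hwz⟩ := ih t h2 ht
      obtain ⟨ν, ⟨e0, e5⟩, h3⟩ := H4 (assign [x, y, p, t, q, z]) ⟨hx, hy, hpt, hqp, hz⟩
      replace e0 : ν 0 = x := e0
      replace e5 : ν 5 = z := e5
      rw [e0, e5] at h3
      exact ⟨z, h3, hwz⟩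

/-! ### The standard model of a trace -/

open Encodable in
/-- The facts about numbers up to `N`, about the lists in `Ls`, and about the evaluations in `T`;
numbers stand for themselves, and lists for their codes. -/
inductive StdFact (L : List Code) (T : Set (Code × List ℕ)) (Ls : Set (List ℕ)) (N : ℕ)
    (v₀ : List ℕ) : Fact → Prop
  | start : StdFact L T Ls N v₀ (0, [])
  | zero : StdFact L T Ls N v₀ (1, [0])
  | succ (k : ℕ) (hk : k < N) : StdFact L T Ls N v₀ (2, [k, k + 1])
  | cons (v : List ℕ) (hv : v ∈ Ls) : StdFact L T Ls N v₀ (3, [v.headI, encode v.tail, encode v])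
  | root : StdFact L T Ls N v₀ (4, [encode v₀])
  | call (c : Code) (v : List ℕ) (h : (c, v) ∈ T) : StdFact L T Ls N v₀ (callRel L c, [encode v])
  | res (c : Code) (v w : List ℕ) (h : (c, v) ∈ T) (hw : w ∈ c.eval v) :
      StdFact L T Ls N v₀ (resRel L c, [encode v, encode w])
  | aux (f g : Code) (v : List ℕ) (n : ℕ) (h : (Code.case f g, v) ∈ T) (hn : v.headI = n + 1) :
      StdFact L T Ls N v₀ (auxRel L (.case f g), [encode v, encode (n :: v.tail)])

section StdFact

open Encodable

variable {L : List Code} {T : Set (Code × List ℕ)} {Ls : Set (List ℕ)} {N : ℕ} {v₀ : List ℕ}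

/-- Numbers and list codes share the same values, but the inversions read them off by relation.
Names below 5 and the three families, distinct modulo 3, never collide, so only one constructor
survives. -/
theorem StdFact.zero_inv {a : ℕ} (h : StdFact L T Ls N v₀ (1, [a])) : a = 0 := by
  generalize hf : ((1, [a]) : Fact) = f at h
  cases h <;> simp only [Prod.mk.injEq, callRel, resRel, auxRel] at hf <;>
    first | omega | simpa using hf

theorem StdFact.succ_inv {a b : ℕ} (h : StdFact L T Ls N v₀ (2, [a, b])) : b = a + 1 := by
  generalize hf : ((2, [a, b]) : Fact) = f at h
  cases h <;> simp only [Prod.mk.injEq, callRel, resRel, auxRel] at hf <;>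
    first | omega | skip
  simp only [List.cons.injEq] at hf
  omega

theorem StdFact.cons_inv {a b x : ℕ} (h : StdFact L T Ls N v₀ (3, [a, b, x])) :
    ∃ v : List ℕ, a = v.headI ∧ b = encode v.tail ∧ x = encode v := by
  generalize hf : ((3, [a, b, x]) : Fact) = f at h
  cases h <;> simp only [Prod.mk.injEq, callRel, resRel, auxRel] at hf <;>
    first | omega | skip
  simp only [List.cons.injEq] at hf
  exact ⟨_, hf.2.1, hf.2.2.1, hf.2.2.2.1⟩

theorem StdFact.root_inv {a : ℕ} (h : StdFact L T Ls N v₀ (4, [a])) : a = encode v₀ := by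
  generalize hf : ((4, [a]) : Fact) = f at h
  cases h <;> simp only [Prod.mk.injEq, callRel, resRel, auxRel] at hf <;>
    first | omega | simpa using hf

/-- Membership in `L` makes the index, hence the relation name, determine the code, even if `L` has
repetitions. -/
theorem StdFact.call_inv {c : Code} (hc : c ∈ L) {a : ℕ}
    (h : StdFact L T Ls N v₀ (callRel L c, [a])) : ∃ v : List ℕ, a = encode v ∧ (c, v) ∈ T := by
  generalize hf : ((callRel L c, [a]) : Fact) = f at h
  cases h <;> simp only [Prod.mk.injEq, callRel, resRel, auxRel] at hf <;>
    first | omega | skip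
  rename_i d v hv
  obtain rfl : c = d := (List.idxOf_inj hc).1 (by omega)
  exact ⟨v, by simpa using hf.2, hv⟩

theorem StdFact.res_inv {c : Code} (hc : c ∈ L) {a b : ℕ}
    (h : StdFact L T Ls N v₀ (resRel L c, [a, b])) :
    ∃ v w : List ℕ, a = encode v ∧ b = encode w ∧ (c, v) ∈ T ∧ w ∈ c.eval v := by
  generalize hf : ((resRel L c, [a, b]) : Fact) = f at h
  cases h <;> simp only [Prod.mk.injEq, callRel, resRel, auxRel] at hf <;>
    first | omega | skip
  rename_i d v w hv hw
  obtain rfl : c = d := (List.idxOf_inj hc).1 (by omega)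
  simp only [List.cons.injEq] at hf
  exact ⟨v, w, hf.2.1, hf.2.2.1, hv, hw⟩

theorem StdFact.aux_inv {f g : Code} (hc : Code.case f g ∈ L) {a b : ℕ}
    (h : StdFact L T Ls N v₀ (auxRel L (.case f g), [a, b])) :
    ∃ (v : List ℕ) (n : ℕ), a = encode v ∧ b = encode (n :: v.tail) ∧ v.headI = n + 1 ∧
      (Code.case f g, v) ∈ T := by
  generalize hf : ((auxRel L (.case f g), [a, b]) : Fact) = F at h
  cases h <;> simp only [Prod.mk.injEq, callRel, resRel, auxRel] at hf <;>
    first | omega | skip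
  rename_i f' g' v n hv hn
  have h : Code.case f g = .case f' g' := (List.idxOf_inj hc).1 (by omega)
  rw [← h] at hv
  simp only [List.cons.injEq] at hf
  exact ⟨v, n, hf.2.1, hf.2.2.1, hn, hv⟩

/-- The list set contains all lists that occur in the trace, and the number bound is large
enough for their heads. -/
structure IsRange (T : Set (Code × List ℕ)) (Ls : Set (List ℕ)) (N : ℕ) : Prop where
  finite : Ls.Finite
  nil : [] ∈ Ls
  arg : ∀ c v, (c, v) ∈ T → v ∈ Ls
  res : ∀ c v w, (c, v) ∈ T → w ∈ c.eval v → w ∈ Ls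
  head : ∀ v ∈ Ls, v.headI ≤ N

/-- Each evaluation has at most one result, so a finite trace involves finitely many lists. Closure
under tails is not required: list facts demanded by a head only build the empty list, an argument or
a result. -/
theorem exists_isRange (hT : T.Finite) : ∃ Ls N, IsRange T Ls N := by
  set Ls : Set (List ℕ) := insert [] (Prod.snd '' T ∪ ⋃ p ∈ T, {w | w ∈ p.1.eval p.2})
  have hLs : Ls.Finite := by
    refine ((hT.image _).union (hT.biUnion fun p _ => Set.Subsingleton.finite ?_)).insert _
    exact fun w hw w' hw' => Part.mem_unique hw hw'
  obtain ⟨N, hN⟩ := (hLs.image List.headI).bddAbove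
  refine ⟨Ls, N, hLs, Set.mem_insert _ _, fun c v h => Or.inr (Or.inl ⟨_, h, rfl⟩),
    fun c v w h hw => Or.inr (Or.inr ?_), fun v hv => hN ⟨v, hv, rfl⟩⟩
  exact Set.mem_biUnion (x := (c, v)) h hw

theorem stdFact_finite (hT : IsTrace L T) (hR : IsRange T Ls N) :
    {F | StdFact L T Ls N v₀ F}.Finite := by
  refine ((((((((Set.finite_singleton ((0, []) : Fact)).insert (1, [0])).insert
    (4, [encode v₀])).union ((Set.finite_Iio N).image fun k => (2, [k, k + 1]))).union
    (hR.finite.image fun v => (3, [v.headI, encode v.tail, encode v]))).union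
    (hT.finite.image fun p => (callRel L p.1, [encode p.2]))).union
    ((hT.finite.prod hR.finite).image fun q =>
      (resRel L q.1.1, [encode q.1.2, encode q.2]))).union
    ((hT.finite.prod hR.finite).image fun q =>
      (auxRel L q.1.1, [encode q.1.2, encode q.2]))).subset ?_
  rintro F (_ | _ | ⟨k, hk⟩ | ⟨v, hv⟩ | _ | ⟨c, v, h⟩ | ⟨c, v, w, h, hw⟩ | ⟨f, g, v, n, h, hn⟩)
  · simp
  · simp
  · exact Or.inl <| Or.inl <| Or.inl <| Or.inl <| Or.inr ⟨k, hk, rfl⟩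
  · exact Or.inl <| Or.inl <| Or.inl <| Or.inr ⟨v, hv, rfl⟩
  · simp
  · exact Or.inl <| Or.inl <| Or.inr ⟨_, h, rfl⟩
  · exact Or.inl <| Or.inr ⟨((c, v), w), ⟨h, hR.res c v w h hw⟩, rfl⟩
  · refine Or.inr ⟨((.case f g, v), n :: v.tail), ⟨h, hR.arg g _ ?_⟩, rfl⟩
    exact hT.closed _ h (by simp [calls, hn])

end StdFact

open Encodable

section

variable {L : List Code} {T : Set (Code × List ℕ)} {Ls : Set (List ℕ)} {N : ℕ} {v₀ : List ℕ}

/-- Inverting the body facts, with injectivity of `encode`, recovers the actual lists. The head then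
holds because the trace is closed under calls, results are computed by `eval`, and the range
contains every list to be built. -/
theorem stdFact_sat (hT : IsTrace L T) (hR : IsRange T Ls N) {c : Code} (hc : subcodes c ⊆ L) :
    ∀ r ∈ codeRules L c, r.Sat {F | StdFact L T Ls N v₀ F} := by
  have hcL := hc (mem_subcodes_self c)
  cases c with
  | zero' =>
    simp only [codeRules, TGD.Sat, List.forall_mem_cons, List.not_mem_nil, false_imp_iff,
      implies_true, and_true, varAtom_holds, List.map_cons, List.map_nil, Set.mem_ofPred_eq]
    intro ν h
    obtain ⟨v, e, hv⟩ := h.call_inv hcL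
    have hr : 0 :: v ∈ Code.zero'.eval v := by simp [Part.pure_eq_some]
    rw [e]
    exact ⟨assign [encode v, 0, encode (0 :: v)], rfl, .zero, .cons (0 :: v) (hR.res _ _ _ hv hr),
      .res _ _ _ hv hr⟩
  | succ =>
    simp only [codeRules, TGD.Sat, List.forall_mem_cons, List.not_mem_nil, false_imp_iff,
      implies_true, and_true, varAtom_holds, List.map_cons, List.map_nil, Set.mem_ofPred_eq]
    rintro ν ⟨h, h'⟩
    obtain ⟨v, e, hv⟩ := h.call_inv hcL
    obtain ⟨v', e1, -, e'⟩ := h'.cons_inv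
    obtain rfl := encode_injective (e.symm.trans e')
    have hr : [v.headI + 1] ∈ Code.succ.eval v := by simp [Part.pure_eq_some]
    rw [e, e1]
    -- Variables 3 to 6 are the successor, zero, the empty list and the result. The result is in the
    -- range, so its head bounds the successor fact: `v.headI + 1 ≤ N`.
    exact ⟨assign [encode v, v.headI, 0, v.headI + 1, 0, encode ([] : List ℕ),
      encode [v.headI + 1]], ⟨rfl, rfl⟩, .succ _ (hR.head _ (hR.res _ _ _ hv hr)), .zero,
      .cons [] hR.nil, .cons [v.headI + 1] (hR.res _ _ _ hv hr), .res _ _ _ hv hr⟩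
  | tail =>
    simp only [codeRules, TGD.Sat, List.forall_mem_cons, List.not_mem_nil, false_imp_iff,
      implies_true, and_true, varAtom_holds, List.map_cons, List.map_nil, Set.mem_ofPred_eq]
    rintro ν ⟨h, h'⟩
    obtain ⟨v, e, hv⟩ := h.call_inv hcL
    obtain ⟨v', -, e2, e'⟩ := h'.cons_inv
    obtain rfl := encode_injective (e.symm.trans e')
    have hr : v.tail ∈ Code.tail.eval v := by simp [Part.pure_eq_some]
    refine ⟨ν, ⟨rfl, rfl⟩, ?_⟩
    rw [e, e2]
    exact .res _ _ _ hv hr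
  | cons f g =>
    have hf : f ∈ L := hc (by simp [subcodes, mem_subcodes_self])
    have hg : g ∈ L := hc (by simp [subcodes, mem_subcodes_self])
    simp only [codeRules, TGD.Sat, List.forall_mem_cons, List.not_mem_nil, false_imp_iff,
      implies_true, and_true, varAtom_holds, List.map_cons, List.map_nil, Set.mem_ofPred_eq]
    constructor
    · intro ν h
      obtain ⟨v, e, hv⟩ := h.call_inv hcL
      refine ⟨ν, rfl, ?_⟩
      rw [e]
      exact ⟨.call _ _ (hT.closed _ hv (by simp [calls])),
        .call _ _ (hT.closed _ hv (by simp [calls]))⟩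
    · rintro ν ⟨h, h1, h2, h3⟩
      obtain ⟨v, e, hv⟩ := h.call_inv hcL
      obtain ⟨v', a, e', ea, -, ha⟩ := h1.res_inv hf
      obtain rfl := encode_injective (e.symm.trans e')
      obtain ⟨v', b, e', eb, -, hb⟩ := h2.res_inv hg
      obtain rfl := encode_injective (e.symm.trans e')
      obtain ⟨a', e1, -, e''⟩ := h3.cons_inv
      obtain rfl := encode_injective (ea.symm.trans e'')
      have hr : a.headI :: b ∈ (Code.cons f g).eval v := mem_eval_cons.2 ⟨a, ha, b, hb, rfl⟩
      rw [e, eb, e1]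
      exact ⟨assign [encode v, 0, encode b, a.headI, 0, encode (a.headI :: b)], ⟨rfl, rfl, rfl⟩,
        .cons (a.headI :: b) (hR.res _ _ _ hv hr), .res _ _ _ hv hr⟩
  | comp f g =>
    have hf : f ∈ L := hc (by simp [subcodes, mem_subcodes_self])
    have hg : g ∈ L := hc (by simp [subcodes, mem_subcodes_self])
    simp only [codeRules, TGD.Sat, List.forall_mem_cons, List.not_mem_nil, false_imp_iff,
      implies_true, and_true, varAtom_holds, List.map_cons, List.map_nil, Set.mem_ofPred_eq]
    refine ⟨?_, ?_, ?_⟩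
    · intro ν h
      obtain ⟨v, e, hv⟩ := h.call_inv hcL
      refine ⟨ν, rfl, ?_⟩
      rw [e]
      exact .call _ _ (hT.closed _ hv (by simp [calls]))
    · rintro ν ⟨h, h1⟩
      obtain ⟨v, e, hv⟩ := h.call_inv hcL
      obtain ⟨v', a, e', ea, -, ha⟩ := h1.res_inv hg
      obtain rfl := encode_injective (e.symm.trans e')
      refine ⟨ν, rfl, ?_⟩
      rw [ea]
      exact .call _ _ (hT.closed _ hv (Or.inr ⟨rfl, ha⟩))
    · rintro ν ⟨h, h1, h2⟩
      obtain ⟨v, e, hv⟩ := h.call_inv hcL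
      obtain ⟨v', a, e', ea, -, ha⟩ := h1.res_inv hg
      obtain rfl := encode_injective (e.symm.trans e')
      obtain ⟨a', b, e', eb, -, hb⟩ := h2.res_inv hf
      obtain rfl := encode_injective (ea.symm.trans e')
      refine ⟨ν, ⟨rfl, rfl⟩, ?_⟩
      rw [e, eb]
      exact .res _ _ _ hv (mem_eval_comp.2 ⟨a, ha, hb⟩)
  | case f g =>
    have hf : f ∈ L := hc (by simp [subcodes, mem_subcodes_self])
    have hg : g ∈ L := hc (by simp [subcodes, mem_subcodes_self])
    simp only [codeRules, TGD.Sat, List.forall_mem_cons, List.not_mem_nil, false_imp_iff,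
      implies_true, and_true, varAtom_holds, List.map_cons, List.map_nil, Set.mem_ofPred_eq]
    refine ⟨?_, ?_, ?_, ?_⟩
    · rintro ν ⟨h, h1, h2⟩
      obtain ⟨v, e, hv⟩ := h.call_inv hcL
      obtain ⟨v', e1, e2, e'⟩ := h1.cons_inv
      obtain rfl := encode_injective (e.symm.trans e')
      have h0 : v.headI = 0 := e1.symm.trans h2.zero_inv
      refine ⟨ν, rfl, ?_⟩
      rw [e2]
      exact .call _ _ (hT.closed _ hv (by simp [calls, h0]))
    · rintro ν ⟨h, h1, h2, h3⟩
      obtain ⟨v, e, hv⟩ := h.call_inv hcL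
      obtain ⟨v', e1, e2, e'⟩ := h1.cons_inv
      obtain rfl := encode_injective (e.symm.trans e')
      have h0 : v.headI = 0 := e1.symm.trans h2.zero_inv
      obtain ⟨t, b, e', eb, -, hb⟩ := h3.res_inv hf
      obtain rfl := encode_injective (e2.symm.trans e')
      refine ⟨ν, ⟨rfl, rfl⟩, ?_⟩
      rw [e, eb]
      exact .res _ _ _ hv (by rwa [eval_case_zero h0])
    · rintro ν ⟨h, h1, h2⟩
      obtain ⟨v, e, hv⟩ := h.call_inv hcL
      obtain ⟨v', e1, e2, e'⟩ := h1.cons_inv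
      obtain rfl := encode_injective (e.symm.trans e')
      have hn : v.headI = ν 3 + 1 := e1.symm.trans h2.succ_inv
      have hgT : (g, ν 3 :: v.tail) ∈ T := hT.closed _ hv (by simp [calls, hn])
      rw [e, e2]
      exact ⟨assign [encode v, 0, encode v.tail, ν 3, encode (ν 3 :: v.tail)], ⟨rfl, rfl, rfl⟩,
        .cons (ν 3 :: v.tail) (hR.arg _ _ hgT), .aux f g v (ν 3) hv hn, .call _ _ hgT⟩
    · rintro ν ⟨h, h1⟩
      obtain ⟨v, n, e, e4, hn, hv⟩ := h.aux_inv hcL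
      obtain ⟨t, b, e', eb, -, hb⟩ := h1.res_inv hg
      obtain rfl := encode_injective (e4.symm.trans e')
      refine ⟨ν, ⟨rfl, rfl⟩, ?_⟩
      rw [e, eb]
      exact .res _ _ _ hv (by rwa [eval_case_succ hn])
  | fix f =>
    have hf : f ∈ L := hc (by simp [subcodes, mem_subcodes_self])
    simp only [codeRules, TGD.Sat, List.forall_mem_cons, List.not_mem_nil, false_imp_iff,
      implies_true, and_true, varAtom_holds, List.map_cons, List.map_nil, Set.mem_ofPred_eq]
    refine ⟨?_, ?_, ?_, ?_⟩
    · intro ν h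
      obtain ⟨v, e, hv⟩ := h.call_inv hcL
      refine ⟨ν, rfl, ?_⟩
      rw [e]
      exact .call _ _ (hT.closed _ hv (by simp [calls]))
    · rintro ν ⟨h, h1, h2, h3⟩
      obtain ⟨v, e, hv⟩ := h.call_inv hcL
      obtain ⟨v', u, e', eu, -, hu⟩ := h1.res_inv hf
      obtain rfl := encode_injective (e.symm.trans e')
      obtain ⟨u', e2, e3, e'⟩ := h2.cons_inv
      obtain rfl := encode_injective (eu.symm.trans e')
      have h0 : u.headI = 0 := e2.symm.trans h3.zero_inv
      refine ⟨ν, ⟨rfl, rfl⟩, ?_⟩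
      rw [e, e3]
      exact .res _ _ _ hv (mem_eval_fix.2 ⟨u, hu, Or.inl ⟨h0, rfl⟩⟩)
    · rintro ν ⟨h, h1, h2, h3⟩
      obtain ⟨v, e, hv⟩ := h.call_inv hcL
      obtain ⟨v', u, e', eu, -, hu⟩ := h1.res_inv hf
      obtain rfl := encode_injective (e.symm.trans e')
      obtain ⟨u', e2, e3, e'⟩ := h2.cons_inv
      obtain rfl := encode_injective (eu.symm.trans e')
      have h0 : u.headI = ν 4 + 1 := e2.symm.trans h3.succ_inv
      refine ⟨ν, rfl, ?_⟩
      rw [e3]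
      exact .call _ _ (hT.closed _ hv (Or.inr ⟨rfl, u, hu, by omega, rfl⟩))
    · rintro ν ⟨h, h1, h2, h3, h4⟩
      obtain ⟨v, e, hv⟩ := h.call_inv hcL
      obtain ⟨v', u, e', eu, -, hu⟩ := h1.res_inv hf
      obtain rfl := encode_injective (e.symm.trans e')
      obtain ⟨u', e2, e3, e'⟩ := h2.cons_inv
      obtain rfl := encode_injective (eu.symm.trans e')
      have h0 : u.headI = ν 4 + 1 := e2.symm.trans h3.succ_inv
      obtain ⟨t, w, e', ew, -, hw⟩ := h4.res_inv hcL
      obtain rfl := encode_injective (e3.symm.trans e')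
      refine ⟨ν, ⟨rfl, rfl⟩, ?_⟩
      rw [e, ew]
      exact .res _ _ _ hv (mem_eval_fix.2 ⟨u, hu, Or.inr ⟨by omega, hw⟩⟩)

end

/-! ### The reduction -/

/-- The dependency that demands the evaluation of `c` at the list `[n]`. -/
def initRule (L : List Code) (c : Code) (n : ℕ) : TGD :=
  ⟨[varAtom 0 []], [], (List.range n).map (fun i => varAtom 2 [i, i + 1]) ++
    [varAtom 1 [0], varAtom 3 [0, n + 1, n + 1], varAtom 3 [n, n + 1, n + 2],
      varAtom 4 [n + 2], varAtom (callRel L c) [n + 2]]⟩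

/-- The pattern that says that the evaluation of `c` has a result with a nonzero head. -/
def badPattern (L : List Code) (c : Code) : List Atom :=
  [varAtom 4 [0], varAtom (resRel L c) [0, 1], varAtom 3 [2, 3, 1], varAtom 2 [4, 2]]

/-- The dependencies for the evaluation of `c` at `[n]`. -/
def evalRules (c : Code) (n : ℕ) : List TGD :=
  initRule (subcodes c) c n :: (subcodes c).flatMap (codeRules (subcodes c))

/-- The number of visible relations of the reduction. -/
def relBound (c : Code) : ℕ := 5 + 3 * (subcodes c).length

/-- The input of the schema-level problem for the evaluation of `c` at `[n]`. -/
def evalInput (c : Code) (n : ℕ) : Input :=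
  tgdInput (relBound c) relArity (badPattern (subcodes c) c) (evalRules c n)

theorem varAtom_fits {B R : ℕ} {xs : List ℕ} (hR : R < B) (hxs : xs.length = relArity R) :
    Atom.Fits B relArity (varAtom R xs) :=
  ⟨hR, by simpa [varAtom] using hxs, varAtom_noConst _ _⟩

theorem relArity_callRel (L : List Code) (c : Code) : relArity (callRel L c) = 1 := by
  have : callRel L c = 3 * L.idxOf c + 5 := by rw [callRel]; omega
  simp [this, relArity]

theorem relArity_resRel (L : List Code) (c : Code) : relArity (resRel L c) = 2 := by
  have : resRel L c = 3 * L.idxOf c + 1 + 5 := by rw [resRel]; omega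
  simp [this, relArity]

theorem relArity_auxRel (L : List Code) (c : Code) : relArity (auxRel L c) = 2 := by
  have : auxRel L c = 3 * L.idxOf c + 2 + 5 := by rw [auxRel]; omega
  simp [this, relArity]

theorem rel_lt {L : List Code} {c : Code} (hc : c ∈ L) : callRel L c < 5 + 3 * L.length ∧
    resRel L c < 5 + 3 * L.length ∧ auxRel L c < 5 + 3 * L.length := by
  have := List.idxOf_lt_length_iff.2 hc
  simp only [callRel, resRel, auxRel]
  omega

theorem codeRules_fits {L : List Code} {c : Code} (hc : subcodes c ⊆ L) :
    ∀ r ∈ codeRules L c, r.Fits (5 + 3 * L.length) relArity := by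
  have hC : ∀ (d : Code) (x : ℕ), d ∈ subcodes c →
      Atom.Fits (5 + 3 * L.length) relArity (varAtom (callRel L d) [x]) :=
    fun d x hd => varAtom_fits (rel_lt (hc hd)).1 (relArity_callRel L d).symm
  have hR : ∀ (d : Code) (x y : ℕ), d ∈ subcodes c →
      Atom.Fits (5 + 3 * L.length) relArity (varAtom (resRel L d) [x, y]) :=
    fun d x y hd => varAtom_fits (rel_lt (hc hd)).2.1 (relArity_resRel L d).symm
  have hA : ∀ (d : Code) (x y : ℕ), d ∈ subcodes c →
      Atom.Fits (5 + 3 * L.length) relArity (varAtom (auxRel L d) [x, y]) :=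
    fun d x y hd => varAtom_fits (rel_lt (hc hd)).2.2 (relArity_auxRel L d).symm
  have h1 : ∀ x : ℕ, Atom.Fits (5 + 3 * L.length) relArity (varAtom 1 [x]) :=
    fun x => varAtom_fits (by omega) rfl
  have h2 : ∀ x y : ℕ, Atom.Fits (5 + 3 * L.length) relArity (varAtom 2 [x, y]) :=
    fun x y => varAtom_fits (by omega) rfl
  have h3 : ∀ x y z : ℕ, Atom.Fits (5 + 3 * L.length) relArity (varAtom 3 [x, y, z]) :=
    fun x y z => varAtom_fits (by omega) rfl
  -- Reducible transparency keeps the three families of relation names apart when the matching fact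
  -- is selected.
  cases c <;>
    simp only [codeRules, TGD.Fits, List.forall_mem_cons, List.not_mem_nil, false_imp_iff,
      implies_true, and_true, h1, h2, h3, true_and] <;>
    (repeat' with_reducible apply And.intro) <;>
    first | with_reducible apply hC | with_reducible apply hR | with_reducible apply hA
  all_goals simp [subcodes, mem_subcodes_self]

theorem evalRules_fits (c : Code) (n : ℕ) :
    ∀ r ∈ evalRules c n, r.Fits (relBound c) relArity := by
  intro r hr
  rcases List.mem_cons.1 hr with rfl | hr
  · refine ⟨?_, ?_⟩
    · simpa [initRule] using varAtom_fits (by simp [relBound]) rfl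
    · intro A hA
      have hpos : 5 ≤ relBound c := by simp [relBound]
      simp only [initRule, List.mem_append, List.mem_map, List.mem_cons, List.not_mem_nil,
        or_false] at hA
      rcases hA with ⟨i, -, rfl⟩ | rfl | rfl | rfl | rfl | rfl
      · exact varAtom_fits (by omega) rfl
      · exact varAtom_fits (by omega) rfl
      · exact varAtom_fits (by omega) rfl
      · exact varAtom_fits (by omega) rfl
      · exact varAtom_fits (by omega) rfl
      · exact varAtom_fits (rel_lt (mem_subcodes_self c)).1 (relArity_callRel _ _).symm
  · obtain ⟨d, hd, hr⟩ := List.mem_flatMap.1 hr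
    exact codeRules_fits (subcodes_subset hd) r hr

theorem badPattern_fits (c : Code) :
    ∀ A ∈ badPattern (subcodes c) c, Atom.Fits (relBound c) relArity A := by
  have hpos : 5 ≤ relBound c := by simp [relBound]
  simp only [badPattern, List.forall_mem_cons, List.not_mem_nil, false_imp_iff, implies_true,
    and_true]
  exact ⟨varAtom_fits (by omega) rfl,
    varAtom_fits (rel_lt (mem_subcodes_self c)).2.1 (relArity_resRel _ _).symm,
    varAtom_fits (by omega) rfl, varAtom_fits (by omega) rfl⟩

theorem evalInput_wellFormed (c : Code) (n : ℕ) :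
    Input.WellFormed (evalInput c n) ∧ Input.NoConst (evalInput c n) :=
  tgdInput_wellFormed (by simp [relBound]) rfl (by simp [badPattern]) (badPattern_fits c)
    (evalRules_fits c n)

/-- If the result has head zero, then there is a positive query implication. -/
theorem existsPQI_evalInput {K : Set Fact → Prop} (hK : ∀ F : Set Fact, F.Finite → K F)
    {c : Code} {n : ℕ} {w : List ℕ} (hw : w ∈ c.eval [n]) (h0 : w.headI = 0) :
    ExistsPQI K (evalInput c n) := by
  obtain ⟨T, hT, hcT⟩ := exists_isTrace (List.Subset.refl (subcodes c)) hw
  obtain ⟨Ls, N, hR⟩ := exists_isRange hT.finite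
  have hfin := stdFact_finite (v₀ := [n]) hT hR
  have hcL := mem_subcodes_self c
  refine existsPQI_of_model (badPattern_fits c) (evalRules_fits c n) ?_ (hK _ hfin)
    (hK _ (hfin.insert _)) .start ?_ ?_
  · have hpos : 5 ≤ relBound c := by simp [relBound]
    rintro F (_ | _ | ⟨k, hk⟩ | ⟨v, hv⟩ | _ | ⟨d, v, h⟩ | ⟨d, v, w, h, hw⟩ | ⟨f, g, v, n, h, hn⟩)
    · exact ⟨by simp only; omega, rfl⟩
    · exact ⟨by simp only; omega, rfl⟩
    · exact ⟨by simp only; omega, rfl⟩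
    · exact ⟨by simp only; omega, rfl⟩
    · exact ⟨by simp only; omega, rfl⟩
    · exact ⟨(rel_lt (hT.mem _ h)).1, (relArity_callRel _ _).symm⟩
    · exact ⟨(rel_lt (hT.mem _ h)).2.1, (relArity_resRel _ _).symm⟩
    · exact ⟨(rel_lt (hT.mem _ h)).2.2, (relArity_auxRel _ _).symm⟩
  · intro r hr
    rcases List.mem_cons.1 hr with rfl | hr
    · intro ν _
      have hn : n ≤ N := hR.head _ (hR.arg _ _ hcT)
      -- Variables up to `n` are the numbers themselves, `n + 1` is the empty list and `n + 2` is
      -- the list `[n]`.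
      refine ⟨fun i => if i ≤ n then i else if i = n + 1 then encode ([] : List ℕ) else encode [n],
        by simp [initRule], ?_⟩
      intro A hA
      simp only [initRule, List.mem_append, List.mem_map, List.mem_cons, List.not_mem_nil,
        or_false, List.mem_range] at hA
      rcases hA with ⟨i, hi, rfl⟩ | rfl | rfl | rfl | rfl | rfl <;> rw [varAtom_holds] <;>
        simp only [List.map_cons, List.map_nil]
      · rw [if_pos (by omega), if_pos (by omega)]
        exact .succ i (by omega)
      · exact .zero
      · simpa using StdFact.cons (L := subcodes c) (T := T) (N := N) (v₀ := [n]) [] hR.nil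
      · simpa using StdFact.cons (L := subcodes c) (T := T) (N := N) (v₀ := [n]) [n]
          (hR.arg _ _ hcT)
      · simpa using StdFact.root (L := subcodes c) (T := T) (N := N) (Ls := Ls) (v₀ := [n])
      · simpa using StdFact.call (L := subcodes c) (N := N) (Ls := Ls) (v₀ := [n]) c [n] hcT
    · obtain ⟨d, hd, hr⟩ := List.mem_flatMap.1 hr
      exact stdFact_sat hT hR (subcodes_subset hd) r hr
  · rintro ⟨ν, h⟩
    simp only [badPattern, List.forall_mem_cons, List.not_mem_nil, false_imp_iff, implies_true,
      and_true, varAtom_holds, List.map_cons, List.map_nil, Set.mem_ofPred_eq] at h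
    obtain ⟨h1, h2, h3, h4⟩ := h
    -- The root fact pins the argument to `[n]`. Its unique result is `w`, whose zero head cannot be
    -- a successor.
    have e0 := h1.root_inv
    obtain ⟨v, u, e, eu, -, hu⟩ := h2.res_inv hcL
    obtain rfl := encode_injective (e0.symm.trans e)
    obtain ⟨u', e2, -, e1⟩ := h3.cons_inv
    obtain rfl := encode_injective (eu.symm.trans e1)
    obtain rfl := Part.mem_unique hu hw
    have := e2.symm.trans h4.succ_inv
    omega

/-- If the result has a nonzero head, then there is no positive query implication. -/
theorem not_existsPQI_evalInput {K : Set Fact → Prop} (hK : ∀ V f, K V → K (insert f V))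
    {c : Code} {n : ℕ} {w : List ℕ} (hw : w ∈ c.eval [n]) (h0 : w.headI ≠ 0) :
    ¬ ExistsPQI K (evalInput c n) := by
  intro h
  obtain ⟨V, hstart, hsat, hbad⟩ := model_of_existsPQI hK (evalRules_fits c n) h
  obtain ⟨ν, -, hν⟩ := hsat _ (List.mem_cons_self ..) (fun _ => 0) (by
    simpa [initRule, varAtom_holds] using hstart)
  simp only [initRule, List.forall_mem_append, List.forall_mem_map, List.mem_range,
    List.forall_mem_cons, List.not_mem_nil, false_imp_iff, implies_true, and_true, varAtom_holds,
    List.map_cons, List.map_nil] at hν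
  obtain ⟨hs, hz, hnil, hcons, hroot, hcall⟩ := hν
  have hnat : ∀ k ≤ n, RepNat V k (ν k) := by
    intro k hk
    induction k with
    | zero => exact hz
    | succ k ih => exact ⟨_, ih (by omega), hs k (by omega)⟩
  obtain ⟨y, hy, hwy⟩ := exists_res_of_call (v := [n])
    (fun d hd r hr => hsat r (List.mem_cons_of_mem _ (List.mem_flatMap.2 ⟨d, hd, hr⟩))) hcall
    ⟨_, _, hnat n le_rfl, ⟨_, hz, hnil⟩, hcons⟩ hw
  obtain ⟨p, t, hp, -, hpt⟩ := hwy.head_tail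
  obtain ⟨m, hm⟩ := Nat.exists_eq_succ_of_ne_zero h0
  rw [hm] at hp
  obtain ⟨q, -, hq⟩ := hp
  -- The result represented in `V` has a head with a predecessor, which is exactly the forbidden
  -- pattern.
  refine hbad ⟨assign [ν (n + 2), y, p, t, q], ?_⟩
  simp only [badPattern, List.forall_mem_cons, List.not_mem_nil, false_imp_iff, implies_true,
    and_true, varAtom_holds, List.map_cons, List.map_nil]
  exact ⟨hroot, hy, hpt, hq⟩

/-- Only the head of the initial dependency depends on `n`, and heads occur only in the query; the
constraint, the schema and all other disjuncts are constant. -/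
theorem computable_evalInput (c : Code) : Computable (evalInput c) := by
  obtain ⟨Q, C, S, h⟩ : ∃ (Q : BUCQ) (C : List DLTGD) (S : Schema), evalInput c = fun n =>
      (([(relBound c, [])] :: ((relBound c + 1, []) :: (initRule (subcodes c) c n).head) :: Q,
        C, S) : Input) := by
    -- The constant parts are read off at `n = 0`; two tails remove the disjunct for `B` and that of
    -- the initial dependency.
    refine ⟨(evalInput c 0).1.tail.tail, (evalInput c 0).2.1, (evalInput c 0).2.2,
      funext fun n => ?_⟩
    simp only [evalInput, tgdInput, tgdQuery, tgdConstraint, tgdSchema, evalRules,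
      List.mapIdx_cons, List.map_cons, List.tail_cons]
    rfl
  have hinl : Primrec (Sum.inl : ℕ → Trm) := Primrec.sumInl
  have hatom : ∀ (R : ℕ) {α : Type} [Primcodable α] (f : α → List Trm), Primrec f →
      Primrec fun a => ((R, f a) : Atom) := fun R _ _ f hf => (Primrec.const R).pair hf
  have hadd : ∀ k : ℕ, Primrec fun n : ℕ => (Sum.inl (n + k) : Trm) := fun k =>
    hinl.comp (Primrec.nat_add.comp .id (.const k))
  have hnil : Primrec fun _ : ℕ => ([] : List Trm) := Primrec.const []
  have hhead : Primrec fun n => (initRule (subcodes c) c n).head := by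
    refine Primrec.list_append.comp (Primrec.list_map Primrec.list_range ?_) ?_
    · exact (hatom 2 (fun i : ℕ => [Sum.inl i, Sum.inl (i + 1)])
        (Primrec.list_cons.comp hinl (Primrec.list_cons.comp (hadd 1) hnil))).comp Primrec.snd
    · refine Primrec.list_cons.comp (Primrec.const _) <| Primrec.list_cons.comp ?_ <|
        Primrec.list_cons.comp ?_ <| Primrec.list_cons.comp ?_ <| Primrec.list_cons.comp ?_ <|
        Primrec.const []
      · exact hatom 3 (fun n : ℕ => [Sum.inl 0, Sum.inl (n + 1), Sum.inl (n + 1)]) <|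
          Primrec.list_cons.comp (.const _) <| Primrec.list_cons.comp (hadd 1) <|
          Primrec.list_cons.comp (hadd 1) hnil
      · exact hatom 3 (fun n : ℕ => [Sum.inl n, Sum.inl (n + 1), Sum.inl (n + 2)]) <|
          Primrec.list_cons.comp hinl <| Primrec.list_cons.comp (hadd 1) <|
          Primrec.list_cons.comp (hadd 2) hnil
      · exact hatom 4 (fun n : ℕ => [Sum.inl (n + 2)]) (Primrec.list_cons.comp (hadd 2) hnil)
      · exact hatom _ (fun n : ℕ => [Sum.inl (n + 2)]) (Primrec.list_cons.comp (hadd 2) hnil)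
  rw [h]
  exact (Primrec.pair (Primrec.list_cons.comp (.const _) <| Primrec.list_cons.comp
    (Primrec.list_cons.comp (.const _) hhead) (.const Q)) (.const (C, S))).to_comp

/-! ### Diagonalization -/

/-- There is a code that computes the diagonal of the universal partial recursive function. -/
theorem exists_diagonal_code : ∃ c : Code, ∀ n m : ℕ,
    m ∈ (Denumerable.ofNat Nat.Partrec.Code n).eval n → [m] ∈ c.eval [n] := by
  have h : Partrec fun n : ℕ => (Denumerable.ofNat Nat.Partrec.Code n).eval n :=
    Nat.Partrec.Code.eval_part.comp (Computable.ofNat _) Computable.id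
  obtain ⟨c, hc⟩ := Code.exists_code (Nat.Partrec'.part_iff₁.2 h)
  refine ⟨c, fun n m hm => ?_⟩
  have := hc ⟨[n], rfl⟩
  change c.eval [n] = _ at this
  rw [this]
  exact (Part.mem_map_iff _).2 ⟨m, hm, rfl⟩

/-- The schema-level problem is undecidable, even without constants, for every class of instances
that contains the finite ones and is closed under the addition of a fact. -/
theorem undecidable_existsPQI {K : Set Fact → Prop} (hfin : ∀ F : Set Fact, F.Finite → K F)
    (hK : ∀ V f, K V → K (insert f V)) :
    UndecidableOn (fun I : Input => Input.WellFormed I ∧ Input.NoConst I) (ExistsPQI K) := by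
  rintro ⟨f, hf, hfK⟩
  obtain ⟨c, hc⟩ := exists_diagonal_code
  have hg : Computable fun n => f (evalInput c n) := hf.comp (computable_evalInput c)
  have hg' : Computable fun n => cond (f (evalInput c n)) 1 0 :=
    Computable.cond hg (Computable.const 1) (Computable.const 0)
  -- `e` computes 1 where the decider accepts and 0 elsewhere. At its own index, the diagonal result
  -- has nonzero head exactly when the decider accepts, opposite to the true answer.
  obtain ⟨e, he⟩ := Nat.Partrec.Code.exists_code.1 (Partrec.nat_iff.1 hg')
  have hmem := hc (encode e) (cond (f (evalInput c (encode e))) 1 0) (by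
    rw [Denumerable.ofNat_encode, he]
    exact Part.mem_some _)
  have hiff := hfK _ (evalInput_wellFormed c (encode e))
  cases hb : f (evalInput c (encode e)) with
  | true =>
    rw [hb] at hmem
    exact not_existsPQI_evalInput hK hmem (by simp) (hiff.1 hb)
  | false =>
    rw [hb] at hmem
    have := hiff.2 (existsPQI_evalInput hfin hmem (by simp))
    rw [hb] at this
    exact absurd this (by simp)

theorem UndecidableOn.mono {α : Type*} [Primcodable α] {D E P : α → Prop}
    (h : UndecidableOn D P) (hDE : ∀ a, D a → E a) : UndecidableOn E P :=
  fun ⟨f, hf, hfP⟩ => h ⟨f, hf, fun a ha => hfP a (hDE a ha)⟩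

end HiddenQI

theorem theorem3p10 :
    (HiddenQI.UndecidableOn HiddenQI.Input.WellFormed
        (HiddenQI.ExistsPQI HiddenQI.FiniteInst) ∧
      HiddenQI.UndecidableOn HiddenQI.Input.WellFormed
        (HiddenQI.ExistsPQI HiddenQI.AnyInst)) ∧
    (HiddenQI.UndecidableOn
        (fun I : HiddenQI.Input => HiddenQI.Input.WellFormed I ∧ HiddenQI.Input.NoConst I)
        (HiddenQI.ExistsPQI HiddenQI.FiniteInst) ∧
      HiddenQI.UndecidableOn
        (fun I : HiddenQI.Input => HiddenQI.Input.WellFormed I ∧ HiddenQI.Input.NoConst I)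
        (HiddenQI.ExistsPQI HiddenQI.AnyInst)) := by
  have hfin := HiddenQI.undecidable_existsPQI (K := HiddenQI.FiniteInst) (fun _ h => h)
    (fun _ f h => Set.Finite.insert f h)
  have hany := HiddenQI.undecidable_existsPQI (K := HiddenQI.AnyInst) (fun _ _ => trivial)
    (fun _ _ _ => trivial)
  exact ⟨⟨hfin.mono fun _ h => h.1, hany.mono fun _ h => h.1⟩, hfin, hany⟩
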